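/- Let $\mathbb K=\mathbb R$ or $\mathbb C$; "smooth" means $C^\infty$ if $\mathbb K=\mathbb R$ and holomorphic if $\mathbb K=\mathbb C$. Write $\mathcal O_s$ for the ring of smooth function germs on $(\mathbb K^s,0)$ and $\theta_s=\mathcal O_s^{\,s}$ for the germs of vector fields. A map-germ is *stable* if each of its unfoldings is trivial. A *1-parameter stable unfolding* (OPSU) of a smooth map-germ $f:(\mathbb K^n,0)\to(\mathbb K^p,0)$ is a stable smooth map-germ $F:(\mathbb K^n\times\mathbb K,0)\to(\mathbb K^p\times\mathbb K,0)$ of the form $F(x,\lambda)=(f_\lambda(x),\lambda)$ with $f_0=f$. The germ $f$ is *$\mathcal A$-finite* if $\mathcal O_n^{\,p}/\bigl(df(\theta_n)+\{\eta\circ f:\eta\in\theta_p\}\bigr)$ has finite dimension over $\mathbb K$. Let $(X,\Lambda)$ be the coordinates of $\mathbb K^p\times\mathbb K$. A field $\eta\in\theta_{p+1}$ is *liftable* for $F$ if $dF(\xi)=\eta\circ F$ for some $\xi\in\theta_{n+1}$. The *degree of substantiality* of $F$ is the least $m\in\mathbb N$ such that $\Lambda^m$ is the last component of a liftable field ($\infty$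 if there is none), and $F$ is *substantial* if this degree is $1$. Two map-germs $F,G:(\mathbb K^n\times\mathbb K,0)\to(\mathbb K^p\times\mathbb K,0)$ are *weak equivalent* if $G\circ\Phi=\Psi\circ F$ for germs of diffeomorphisms $\Phi$ of $(\mathbb K^{n+1},0)$ and $\Psi$ of $(\mathbb K^{p+1},0)$ whose last components are multiples, in $\mathcal O_{n+1}$ and $\mathcal O_{p+1}$, of the last variables $\lambda$ and $\Lambda$ (the cofactors are then units). **Proposition.** Let $F$ and $G$ be OPSUs of smooth map-germs $f$ and $g$ from $(\mathbb K^n,0)$ to $(\mathbb K^p,0)$, with $f$ $\mathcal A$-finite. If $F$ and $G$ are weak equivalent, then $F$ is substantial if and only if $G$ is substantial. This holds under either convention for $\mathbb N$ (with or without $0$) in the definition of the degree of substantiality. -/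

import Mathlib

open Filter Topology
open scoped ContDiff

namespace Unfoldings

/-! Map-germs at the origin are represented by functions on the whole space; two functions
represent the same germ when they are eventually equal along `𝓝 0`. The field `𝕜` is `ℝ` or `ℂ`. -/

section Germs

variable (𝕜 : Type*) [RCLike 𝕜]
variable {E : Type*} [NormedAddCommGroup E] [NormedSpace 𝕜 E]
variable {E' : Type*} [NormedAddCommGroup E'] [NormedSpace 𝕜 E']
variable {P : Type*} [NormedAddCommGroup P] [NormedSpace 𝕜 P]

/-- `f` is smooth on a neighbourhood of the origin: infinitely differentiable for `𝕜 = ℝ`,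
holomorphic for `𝕜 = ℂ`. -/
def SmoothNear (f : E → E') : Prop :=
  ∀ᶠ x in 𝓝 (0 : E), ContDiffAt 𝕜 ∞ f x

/-- `f` represents a smooth map-germ `(E, 0) → (E', 0)`. -/
structure IsMapGerm (f : E → E') : Prop where
  smooth : SmoothNear 𝕜 f
  map_zero : f 0 = 0

/-- `Φ` represents a germ of diffeomorphism `(E, 0) → (E, 0)`. -/
def IsDiffeoGerm (Φ : E → E) : Prop :=
  IsMapGerm 𝕜 Φ ∧ ∃ Θ : E → E, IsMapGerm 𝕜 Θ ∧
    (∀ᶠ x in 𝓝 (0 : E), Θ (Φ x) = x) ∧ (∀ᶠ x in 𝓝 (0 : E), Φ (Θ x) = x)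

/-- `H(x, u) = (h_u(x), u)` represents an unfolding of `f`, with parameter space `P`: a smooth
map-germ `(E × P, 0) → (E' × P, 0)` with `h_0 = f`. -/
structure IsUnfolding (f : E → E') (H : E × P → E' × P) : Prop where
  isMapGerm : IsMapGerm 𝕜 H
  snd_eq : ∀ᶠ z in 𝓝 (0 : E × P), (H z).2 = z.2
  fst_eq : ∀ᶠ x in 𝓝 (0 : E), (H (x, 0)).1 = f x

/-- The unfolding `H` of `f` is trivial: up to diffeomorphisms in source and target that are
unfoldings of the identity, it is the constant unfolding `f × id`. -/
def IsTrivialUnfolding (f : E → E') (H : E × P → E' × P) : Prop :=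
  ∃ (Φ : E × P → E × P) (Ψ : E' × P → E' × P),
    IsDiffeoGerm 𝕜 Φ ∧ IsUnfolding 𝕜 (id : E → E) Φ ∧
    IsDiffeoGerm 𝕜 Ψ ∧ IsUnfolding 𝕜 (id : E' → E') Ψ ∧
    ∀ᶠ z in 𝓝 (0 : E × P), H (Φ z) = Ψ (f z.1, z.2)

/-- The map-germ `f` is stable: every unfolding of it, with any number of parameters,
is trivial. -/
def IsStable (f : E → E') : Prop :=
  IsMapGerm 𝕜 f ∧ ∀ (r : ℕ) (H : E × (Fin r → 𝕜) → E' × (Fin r → 𝕜)),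
    IsUnfolding 𝕜 f H → IsTrivialUnfolding 𝕜 f H

/-- `F` is a 1-parameter stable unfolding (OPSU) of `f`. -/
def IsOPSU (f : E → E') (F : E × 𝕜 → E' × 𝕜) : Prop :=
  IsUnfolding 𝕜 f F ∧ IsStable 𝕜 F

/-- (Representatives of) smooth vector fields along a germ `(E, 0) → (E', 0)`; no condition is
put on the value at `0`. -/
def fieldsAlong (E E' : Type*) [NormedAddCommGroup E] [NormedSpace 𝕜 E]
    [NormedAddCommGroup E'] [NormedSpace 𝕜 E'] : Submodule 𝕜 (E → E') where
  carrier := {v | SmoothNear 𝕜 v}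
  add_mem' := fun ha hb => (ha.and hb).mono fun _ h => h.1.add h.2
  zero_mem' := Eventually.of_forall fun _ => contDiffAt_const
  smul_mem' := fun _ _ ha => ha.mono fun _ h => contDiffAt_const.smul h

/-- The extended tangent space `tf(θ_E) + ωf(θ_E')` for `𝒜`-equivalence, inside the vector fields
along `f`. It contains the fields whose germ at `0` vanishes, so the quotient by it is the quotient
of the corresponding spaces of germs. -/
def extTangentA (f : E → E') : Submodule 𝕜 (fieldsAlong 𝕜 E E') where
  carrier := {v | ∃ ξ ∈ fieldsAlong 𝕜 E E, ∃ η ∈ fieldsAlong 𝕜 E' E',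
    ∀ᶠ x in 𝓝 (0 : E), v.1 x = fderiv 𝕜 f x (ξ x) + η (f x)}
  add_mem' := by
    rintro a b ⟨ξ, hξ, η, hη, h⟩ ⟨ξ', hξ', η', hη', h'⟩
    refine ⟨ξ + ξ', add_mem hξ hξ', η + η', add_mem hη hη', ?_⟩
    filter_upwards [h, h'] with x hx hx'
    simp only [Submodule.coe_add, Pi.add_apply, hx, hx', map_add]
    abel
  zero_mem' := ⟨0, zero_mem _, 0, zero_mem _, Eventually.of_forall fun x => by simp⟩
  smul_mem' := by
    rintro c a ⟨ξ, hξ, η, hη, h⟩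
    refine ⟨c • ξ, Submodule.smul_mem _ c hξ, c • η, Submodule.smul_mem _ c hη, ?_⟩
    filter_upwards [h] with x hx
    simp [hx]

/-- `f` is `𝒜`-finite: its extended normal space has finite dimension over `𝕜`. -/
def IsAFinite (f : E → E') : Prop :=
  FiniteDimensional 𝕜 (fieldsAlong 𝕜 E E' ⧸ extTangentA 𝕜 f)

/-- `η` represents a liftable vector field of `f`: a smooth vector field on the target with
`df(ξ) = η ∘ f` for some smooth vector field `ξ` on the source. -/
def IsLiftable (f : E → E') (η : E' → E') : Prop :=
  SmoothNear 𝕜 η ∧ ∃ ξ : E → E, SmoothNear 𝕜 ξ ∧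
    ∀ᶠ x in 𝓝 (0 : E), fderiv 𝕜 f x (ξ x) = η (f x)

/-- `dπ(Lift F)`, where `π(X, Λ) = Λ`: the germs of the last components of liftable fields. -/
def lastComponents (F : E × 𝕜 → E' × 𝕜) : Set (E' × 𝕜 → 𝕜) :=
  {g | ∃ η : E' × 𝕜 → E' × 𝕜, IsLiftable 𝕜 F η ∧ ∀ᶠ Y in 𝓝 (0 : E' × 𝕜), g Y = (η Y).2}

/-- The degree of substantiality of `F`: the least `m` with `Λ ^ m ∈ dπ(Lift F)`, and `⊤` if there
is none. Here `m` ranges over the natural numbers starting from `m₀`, so that `m₀ = 0` and `m₀ = 1`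
are the two conventions for the natural numbers. -/
noncomputable def degreeOfSubstantiality (m₀ : ℕ) (F : E × 𝕜 → E' × 𝕜) : ℕ∞ :=
  ⨅ (m : ℕ) (_ : m₀ ≤ m ∧ (fun Y : E' × 𝕜 => Y.2 ^ m) ∈ lastComponents 𝕜 F), (m : ℕ∞)

/-- `F` is substantial: its degree of substantiality is `1`. -/
def IsSubstantial (m₀ : ℕ) (F : E × 𝕜 → E' × 𝕜) : Prop :=
  degreeOfSubstantiality 𝕜 m₀ F = 1

/-- A weak diffeomorphism: a germ of diffeomorphism whose last component is a multiple of the last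
variable in the ring of smooth function germs (the cofactor is then automatically a unit). -/
def IsWeakDiffeo (Φ : E × 𝕜 → E × 𝕜) : Prop :=
  IsDiffeoGerm 𝕜 Φ ∧ ∃ a : E × 𝕜 → 𝕜, SmoothNear 𝕜 a ∧
    ∀ᶠ z in 𝓝 (0 : E × 𝕜), (Φ z).2 = z.2 * a z

/-- `F` and `G` are weak equivalent: `G ∘ Φ = Ψ ∘ F` for weak diffeomorphisms `Φ`, `Ψ`. -/
def WeakEquivalent (F G : E × 𝕜 → E' × 𝕜) : Prop :=
  ∃ (Φ : E × 𝕜 → E × 𝕜) (Ψ : E' × 𝕜 → E' × 𝕜), IsWeakDiffeo 𝕜 Φ ∧ IsWeakDiffeo 𝕜 Ψ ∧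
    ∀ᶠ z in 𝓝 (0 : E × 𝕜), G (Φ z) = Ψ (F z)

end Germs

end Unfoldings

/-! The last components of liftable fields form an ideal `I(F)` of germs, and substantiality asks
whether `Λ ∈ I(F)` (and, if `0` counts as a natural number, also `1 ∉ I(F)`). A weak equivalence
`(Φ, Ψ)` carries liftable fields to liftable fields. A field with last component `1` goes to one
whose last component is a unit, so `1 ∈ I(F)` iff `1 ∈ I(G)`; in that case `Λ` lies in both ideals.

Suppose `1` lies in neither. A liftable `η` with last component `Λ` is carried to a field with last
component `Λ c`, and `c` is a unit as soon as `η 0 = 0`. It remains to exclude `η 0 ≠ 0`, which is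
where `𝒜`-finiteness enters (`one_mem_lastComponents_of_ne_zero`). For every linear form `ℓ` on the
target of `f`, finite codimension and stability put some `ℓ ^ k + Λ β` in `I(F)`
(`exists_pow_add_mem_lastComponents`). Since brackets of liftable fields are liftable, `I(F) + (Λ)`
is stable under differentiation along `η`. If `ℓ` does not vanish on `η 0`, then `k`
differentiations turn `ℓ ^ k` into a unit (`one_mem_lastComponents_of_pow`), so `1 ∈ I(F)`, a
contradiction. -/

namespace Unfoldings

/-! ### Integrals depending on parameters, and Hadamard's lemma -/

section Hadamard

universe u

/-- Domination comes from compactness of `[0, 1]`: a bound `C` for the partial derivative at `z₀`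
becomes `C + 1` uniformly in `t` for nearby `z`. -/
theorem hasFDerivAt_integral_unitInterval {𝕜 : Type u} [RCLike 𝕜]
    {E : Type u} [NormedAddCommGroup E] [NormedSpace 𝕜 E]
    {F : Type u} [NormedAddCommGroup F] [NormedSpace 𝕜 F] [NormedSpace ℝ F] [IsScalarTower ℝ 𝕜 F]
    {h : 𝕜 × E → F} {U : Set E} (hU : IsOpen U)
    (hh : ∀ t ∈ Set.Icc (0 : ℝ) 1, ∀ z ∈ U, ContDiffAt 𝕜 1 h ((t : 𝕜), z)) {z₀ : E} (hz₀ : z₀ ∈ U) :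
    HasFDerivAt (fun z => ∫ t in (0 : ℝ)..1, h ((t : 𝕜), z))
      (∫ t in (0 : ℝ)..1, (fderiv 𝕜 h ((t : 𝕜), z₀)).comp (ContinuousLinearMap.inr 𝕜 𝕜 E)) z₀ := by
  have hofReal : Continuous (fun t : ℝ => (t : 𝕜)) := RCLike.continuous_ofReal
  have hI : Set.uIoc (0 : ℝ) 1 ⊆ Set.Icc 0 1 := by
    rw [Set.uIoc_of_le zero_le_one]; exact Set.Ioc_subset_Icc_self
  set D : 𝕜 × E → E →L[𝕜] F := fun w => (fderiv 𝕜 h w).comp (ContinuousLinearMap.inr 𝕜 𝕜 E)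
    with hD
  have hDc : ∀ t ∈ Set.Icc (0 : ℝ) 1, ∀ z ∈ U, ContinuousAt D ((t : 𝕜), z) := fun t ht z hz =>
    ((hh t ht z hz).fderiv_right (m := 0) (by simp)).continuousAt.clm_comp continuousAt_const
  have hcont : ∀ z ∈ U, ContinuousOn (fun t : ℝ => h ((t : 𝕜), z)) (Set.Icc 0 1) :=
    fun z hz t ht => ((hh t ht z hz).continuousAt.comp (f := fun t : ℝ => ((t : 𝕜), z))
      (hofReal.prodMk continuous_const).continuousAt).continuousWithinAt
  have hDcont : ContinuousOn (fun t : ℝ => D ((t : 𝕜), z₀)) (Set.Icc 0 1) :=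
    fun t ht => ((hDc t ht z₀ hz₀).comp (f := fun t : ℝ => ((t : 𝕜), z₀))
      (hofReal.prodMk continuous_const).continuousAt).continuousWithinAt
  obtain ⟨C, hC⟩ := isCompact_Icc.exists_bound_of_continuousOn hDcont
  have hbound : ∀ᶠ z in 𝓝 z₀, ∀ t ∈ Set.Icc (0 : ℝ) 1, ‖D ((t : 𝕜), z)‖ < C + 1 := by
    refine isCompact_Icc.eventually_forall_of_forall_eventually fun t ht => ?_
    have h1 : ContinuousAt (D ∘ fun w : E × ℝ => ((w.2 : 𝕜), w.1)) (z₀, t) :=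
      ContinuousAt.comp (hDc t ht z₀ hz₀)
        ((hofReal.comp continuous_snd).prodMk continuous_fst).continuousAt
    exact h1.norm.eventually_lt continuousAt_const (by simpa using (hC t ht).trans_lt (lt_add_one C))
  refine intervalIntegral.hasFDerivAt_integral_of_dominated_of_fderiv_le
    (F := fun z t => h ((t : 𝕜), z)) (F' := fun z t => D ((t : 𝕜), z)) (bound := fun _ => C + 1)
    (inter_mem hbound (hU.mem_nhds hz₀)) ?_ ?_ ?_ ?_ ?_ ?_
  · filter_upwards [hU.mem_nhds hz₀] with z hz
    exact ((hcont z hz).mono hI).aestronglyMeasurable measurableSet_uIoc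
  · exact ((hcont z₀ hz₀).mono (by rw [Set.uIcc_of_le zero_le_one])).intervalIntegrable
  · exact (hDcont.mono hI).aestronglyMeasurable measurableSet_uIoc
  · exact Eventually.of_forall fun t ht z hz => (hz.1 t (hI ht)).le
  · exact intervalIntegrable_const
  · refine Eventually.of_forall fun t ht z hz => ?_
    have h1 := ((hh t (hI ht) z hz.2).differentiableAt one_ne_zero).hasFDerivAt
    exact h1.comp z (hasFDerivAt_prodMk_right (t : 𝕜) z)

/-- The derivative is again an integral of this kind, with values in `E →L[𝕜] F`. Hence the
induction varies `F`, and all spaces share one universe. -/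
theorem contDiffOn_integral_unitInterval {𝕜 : Type u} [RCLike 𝕜]
    {E : Type u} [NormedAddCommGroup E] [NormedSpace 𝕜 E] {U : Set E} (hU : IsOpen U) (n : ℕ) :
    ∀ {F : Type u} [NormedAddCommGroup F] [NormedSpace 𝕜 F] [NormedSpace ℝ F]
      [IsScalarTower ℝ 𝕜 F] {h : 𝕜 × E → F},
      (∀ t ∈ Set.Icc (0 : ℝ) 1, ∀ z ∈ U, ContDiffAt 𝕜 (n + 1) h ((t : 𝕜), z)) →
      ContDiffOn 𝕜 n (fun z => ∫ t in (0 : ℝ)..1, h ((t : 𝕜), z)) U := by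
  induction n with
  | zero =>
    intro F _ _ _ _ h hh
    rw [Nat.cast_zero, contDiffOn_zero]
    intro z hz
    exact (hasFDerivAt_integral_unitInterval hU (fun t ht z hz => by simpa using hh t ht z hz)
      hz).continuousAt.continuousWithinAt
  | succ n ih =>
    intro F _ _ _ _ h hh
    have hd := fun z hz => hasFDerivAt_integral_unitInterval (z₀ := z) hU
      (fun t ht z hz => (hh t ht z hz).of_le (by exact_mod_cast Nat.le_add_left 1 _)) hz
    rw [Nat.cast_succ, contDiffOn_succ_iff_fderiv_of_isOpen hU]
    refine ⟨fun z hz => (hd z hz).differentiableAt.differentiableWithinAt, by simp, ?_⟩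
    refine (ih (F := E →L[𝕜] F)
      (h := fun w => (fderiv 𝕜 h w).comp (ContinuousLinearMap.inr 𝕜 𝕜 E)) ?_).congr
      fun z hz => (hd z hz).fderiv
    intro t ht z hz
    exact ((hh t ht z hz).fderiv_right (m := n + 1) (by norm_cast)).clm_comp contDiffAt_const

/-- Hadamard's lemma: a smooth germ on `E × 𝕜` that vanishes on `E × 0` is divisible by the last
variable. -/
theorem SmoothNear.exists_eq_snd_smul {𝕜 : Type u} [RCLike 𝕜]
    {E : Type u} [NormedAddCommGroup E] [NormedSpace 𝕜 E]
    {F : Type u} [NormedAddCommGroup F] [NormedSpace 𝕜 F] [CompleteSpace F]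
    {v : E × 𝕜 → F} (hv : SmoothNear 𝕜 v) (hv0 : ∀ᶠ x in 𝓝 (0 : E), v (x, 0) = 0) :
    ∃ w : E × 𝕜 → F, SmoothNear 𝕜 w ∧ ∀ᶠ z in 𝓝 (0 : E × 𝕜), v z = z.2 • w z := by
  let _ : NormedSpace ℝ F := NormedSpace.restrictScalars ℝ 𝕜 F
  have _ : IsScalarTower ℝ 𝕜 F := RestrictScalars.isScalarTower ℝ 𝕜 F
  obtain ⟨r, hr, hball⟩ := Metric.eventually_nhds_iff_ball.1
    (hv.and ((continuous_fst.tendsto' (0 : E × 𝕜) 0 rfl).eventually hv0))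
  -- The quotient is `∫₀¹ ∂v/∂λ (x, tλ) dt`. The scaling parameter ranges over `𝕜`, so that `h` is
  -- `𝕜`-smooth jointly in all variables.
  set S : 𝕜 × (E × 𝕜) → E × 𝕜 := fun w => (w.2.1, w.1 * w.2.2) with hS
  have hSsmooth : ContDiff 𝕜 ∞ S := by fun_prop
  have hmaps : ∀ t ∈ Set.Icc (0 : ℝ) 1, ∀ z ∈ Metric.ball (0 : E × 𝕜) r,
      S ((t : 𝕜), z) ∈ Metric.ball (0 : E × 𝕜) r := by
    intro t ht z hz
    rw [mem_ball_zero_iff, Prod.norm_def, max_lt_iff] at hz ⊢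
    refine ⟨hz.1, ?_⟩
    rw [norm_mul, RCLike.norm_ofReal, abs_of_nonneg ht.1]
    exact (mul_le_of_le_one_left (norm_nonneg _) ht.2).trans_lt hz.2
  set h : 𝕜 × (E × 𝕜) → F := fun w => fderiv 𝕜 v (S w) ((0 : E), (1 : 𝕜)) with hh
  have hsm : ∀ t ∈ Set.Icc (0 : ℝ) 1, ∀ z ∈ Metric.ball (0 : E × 𝕜) r,
      ContDiffAt 𝕜 ∞ h ((t : 𝕜), z) := by
    intro t ht z hz
    have h1 := (hball _ (hmaps t ht z hz)).1.fderiv_right (m := ∞) le_rfl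
    exact (h1.comp ((t : 𝕜), z) hSsmooth.contDiffAt).clm_apply contDiffAt_const
  refine ⟨fun z => ∫ t in (0 : ℝ)..1, h ((t : 𝕜), z), ?_, ?_⟩
  · filter_upwards [Metric.ball_mem_nhds (0 : E × 𝕜) hr] with z hz
    rw [contDiffAt_infty]
    intro n
    exact (contDiffOn_integral_unitInterval Metric.isOpen_ball n
      (fun t ht z hz => (hsm t ht z hz).of_le (mod_cast le_top))).contDiffAt
      (Metric.isOpen_ball.mem_nhds hz)
  · filter_upwards [Metric.ball_mem_nhds (0 : E × 𝕜) hr] with z hz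
    have hderiv : ∀ t ∈ Set.uIcc (0 : ℝ) 1,
        HasDerivAt (fun t : ℝ => v (S ((t : 𝕜), z))) (z.2 • h ((t : 𝕜), z)) t := by
      intro t ht
      rw [Set.uIcc_of_le zero_le_one] at ht
      have h1 := ((hball _ (hmaps t ht z hz)).1.differentiableAt (by simp)).hasFDerivAt
      have h2 : HasDerivAt (fun s : 𝕜 => S (s, z)) ((0 : E), z.2) (t : 𝕜) := by
        have := (hasDerivAt_const (t : 𝕜) z.1).prodMk ((hasDerivAt_id (t : 𝕜)).mul_const z.2)
        simpa [hS] using this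
      have h3 := (h1.comp_hasDerivAt (t : 𝕜) h2).scomp (𝕜 := ℝ) t
        (RCLike.ofRealCLM (K := 𝕜)).hasDerivAt
      have h4 : ((0 : E), z.2) = z.2 • ((0 : E), (1 : 𝕜)) := by simp
      rw [h4, map_smul] at h3
      simpa [hh, Function.comp_def] using h3
    have hcont : ContinuousOn (fun t : ℝ => z.2 • h ((t : 𝕜), z)) (Set.uIcc 0 1) := by
      intro t ht
      rw [Set.uIcc_of_le zero_le_one] at ht
      exact (((hsm t ht z hz).continuousAt.comp (f := fun t : ℝ => ((t : 𝕜), z))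
        (RCLike.continuous_ofReal.prodMk continuous_const).continuousAt).const_smul
        z.2).continuousWithinAt
    have hftc := intervalIntegral.integral_eq_sub_of_hasDerivAt hderiv hcont.intervalIntegrable
    have h0 : v (z.1, 0) = 0 := (hball z hz).2
    have h5 : ∫ t in (0 : ℝ)..1, z.2 • h ((t : 𝕜), z) = z.2 • ∫ t in (0 : ℝ)..1, h ((t : 𝕜), z) :=
      intervalIntegral.integral_smul z.2 _
    rw [← h5, hftc]
    simp [hS, h0]

end Hadamard

/-! ### Calculus of germs, infinitesimal stability, liftable fields -/

section Calculus

variable {𝕜 : Type*} [RCLike 𝕜]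
variable {E : Type*} [NormedAddCommGroup E] [NormedSpace 𝕜 E]
variable {E' : Type*} [NormedAddCommGroup E'] [NormedSpace 𝕜 E']
variable {E'' : Type*} [NormedAddCommGroup E''] [NormedSpace 𝕜 E'']

theorem _root_.ContDiff.smoothNear {f : E → E'} (hf : ContDiff 𝕜 ∞ f) : SmoothNear 𝕜 f :=
  Eventually.of_forall fun _ => hf.contDiffAt

theorem SmoothNear.congr {f g : E → E'} (hf : SmoothNear 𝕜 f) (h : ∀ᶠ x in 𝓝 (0 : E), g x = f x) :
    SmoothNear 𝕜 g := by
  filter_upwards [hf, h.eventually_nhds] with x hx hgx using hx.congr_of_eventuallyEq hgx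

theorem SmoothNear.add {f g : E → E'} (hf : SmoothNear 𝕜 f) (hg : SmoothNear 𝕜 g) :
    SmoothNear 𝕜 fun x => f x + g x :=
  (hf.and hg).mono fun _ h => h.1.add h.2

theorem SmoothNear.sub {f g : E → E'} (hf : SmoothNear 𝕜 f) (hg : SmoothNear 𝕜 g) :
    SmoothNear 𝕜 fun x => f x - g x :=
  (hf.and hg).mono fun _ h => h.1.sub h.2

theorem SmoothNear.neg {f : E → E'} (hf : SmoothNear 𝕜 f) : SmoothNear 𝕜 fun x => -f x :=
  hf.mono fun _ h => h.neg

theorem SmoothNear.smul {a : E → 𝕜} {f : E → E'} (ha : SmoothNear 𝕜 a) (hf : SmoothNear 𝕜 f) :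
    SmoothNear 𝕜 fun x => a x • f x :=
  (ha.and hf).mono fun _ h => h.1.smul h.2

theorem SmoothNear.mul {a b : E → 𝕜} (ha : SmoothNear 𝕜 a) (hb : SmoothNear 𝕜 b) :
    SmoothNear 𝕜 fun x => a x * b x :=
  ha.smul hb

theorem SmoothNear.prodMk {f : E → E'} {g : E → E''} (hf : SmoothNear 𝕜 f)
    (hg : SmoothNear 𝕜 g) : SmoothNear 𝕜 fun x => (f x, g x) :=
  (hf.and hg).mono fun _ h => h.1.prodMk h.2

theorem SmoothNear.fst {f : E → E' × E''} (hf : SmoothNear 𝕜 f) : SmoothNear 𝕜 fun x => (f x).1 :=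
  hf.mono fun _ h => h.fst

theorem SmoothNear.snd {f : E → E' × E''} (hf : SmoothNear 𝕜 f) : SmoothNear 𝕜 fun x => (f x).2 :=
  hf.mono fun _ h => h.snd

theorem SmoothNear.continuousAt {f : E → E'} (hf : SmoothNear 𝕜 f) : ContinuousAt f 0 :=
  hf.self_of_nhds.continuousAt

theorem SmoothNear.eventually_ne {f : E → 𝕜} (hf : SmoothNear 𝕜 f) (h0 : f 0 ≠ 0) :
    ∀ᶠ x in 𝓝 (0 : E), f x ≠ 0 :=
  hf.continuousAt.eventually_ne h0

theorem SmoothNear.inv {f : E → 𝕜} (hf : SmoothNear 𝕜 f) (h0 : f 0 ≠ 0) :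
    SmoothNear 𝕜 fun x => (f x)⁻¹ :=
  (hf.and (hf.eventually_ne h0)).mono fun _ h => h.1.inv h.2

theorem SmoothNear.fderiv_apply {f : E → E'} {ξ : E → E} (hf : SmoothNear 𝕜 f)
    (hξ : SmoothNear 𝕜 ξ) : SmoothNear 𝕜 fun x => fderiv 𝕜 f x (ξ x) :=
  (hf.and hξ).mono fun _ h => (h.1.fderiv_right (m := ∞) le_rfl).clm_apply h.2

theorem IsMapGerm.tendsto {f : E → E'} (hf : IsMapGerm 𝕜 f) : Tendsto f (𝓝 0) (𝓝 0) := by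
  simpa [hf.map_zero] using hf.smooth.continuousAt.tendsto

theorem SmoothNear.comp {g : E' → E''} {f : E → E'} (hg : SmoothNear 𝕜 g) (hf : IsMapGerm 𝕜 f) :
    SmoothNear 𝕜 fun x => g (f x) := by
  filter_upwards [hf.smooth, hf.tendsto.eventually hg] with x hx hgx using hgx.comp x hx

theorem _root_.ContDiffAt.hasFDerivAt_fderiv {f : E → E'} {x : E} (hf : ContDiffAt 𝕜 ∞ f x) :
    HasFDerivAt f (fderiv 𝕜 f x) x :=
  (hf.differentiableAt (by simp)).hasFDerivAt

theorem smoothNear_snd : SmoothNear 𝕜 (fun Y : E × 𝕜 => Y.2) := contDiff_snd.smoothNear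

theorem isMapGerm_fst : IsMapGerm 𝕜 (fun Y : E × E' => Y.1) := ⟨contDiff_fst.smoothNear, rfl⟩

theorem isMapGerm_prodMk_zero : IsMapGerm 𝕜 (fun x : E => (x, (0 : E'))) :=
  ⟨(contDiff_prodMk_left 0).smoothNear, rfl⟩

/-- Stable germs are infinitesimally stable. -/
theorem IsStable.exists_eq_fderiv_add {F : E → E'} (hF : IsStable 𝕜 F) {w : E → E'}
    (hw : SmoothNear 𝕜 w) :
    ∃ ξ : E → E, SmoothNear 𝕜 ξ ∧ ∃ η : E' → E', SmoothNear 𝕜 η ∧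
      ∀ᶠ z in 𝓝 (0 : E), w z = fderiv 𝕜 F z (ξ z) + η (F z) := by
  obtain ⟨hFg, hst⟩ := hF
  have hsmooth : SmoothNear 𝕜 fun q : E × (Fin 1 → 𝕜) => F q.1 + q.2 0 • w q.1 :=
    (hFg.smooth.comp isMapGerm_fst).add
      (SmoothNear.smul (ContDiff.smoothNear (by fun_prop)) (hw.comp isMapGerm_fst))
  -- Trivialise the one-parameter unfolding `F + s w`.
  obtain ⟨Φ, Ψ, hΦ, hΦu, hΨ, hΨu, hΦΨ⟩ := hst 1
    (fun q => (F q.1 + q.2 0 • w q.1, q.2))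
    ⟨⟨hsmooth.prodMk contDiff_snd.smoothNear, by simp [hFg.map_zero]⟩,
      Eventually.of_forall fun _ => rfl, Eventually.of_forall fun _ => by simp⟩
  set e : Fin 1 → 𝕜 := fun _ => 1 with he
  -- With `φ_s`, `ψ_s` the trivialising families, the `s`-derivative at `0` of `F ∘ φ_s + s (w ∘
  -- φ_s) = ψ_s ∘ F` is `dF(φ') + w = ψ' ∘ F`.
  refine ⟨fun z => -(fderiv 𝕜 Φ (z, 0) (0, e)).1,
    ((hΦ.1.smooth.fderiv_apply contDiff_const.smoothNear).comp
      isMapGerm_prodMk_zero).fst.neg,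
    fun y => (fderiv 𝕜 Ψ (y, 0) (0, e)).1,
    ((hΨ.1.smooth.fderiv_apply contDiff_const.smoothNear).comp isMapGerm_prodMk_zero).fst, ?_⟩
  have hi : Tendsto (fun z : E => (z, (0 : Fin 1 → 𝕜))) (𝓝 0) (𝓝 0) :=
    isMapGerm_prodMk_zero (𝕜 := 𝕜).tendsto
  have hi' : Tendsto (fun z : E => (F z, (0 : Fin 1 → 𝕜))) (𝓝 0) (𝓝 0) :=
    (isMapGerm_prodMk_zero (𝕜 := 𝕜)).tendsto.comp hFg.tendsto
  filter_upwards [hi.eventually hΦΨ.eventually_nhds, hi.eventually hΦu.snd_eq.eventually_nhds,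
    hΦu.fst_eq, hFg.smooth, hw, hi.eventually hΦ.1.smooth, hi'.eventually hΨ.1.smooth]
    with z h1 h2 h3 hFz hwz hΦz hΨz
  have hΦz0 : Φ (z, 0) = (z, 0) := Prod.ext h3 h2.self_of_nhds
  have hγ : HasDerivAt (fun s : 𝕜 => (z, s • e)) ((0 : E), e) 0 := by
    simpa using (hasDerivAt_const (0 : 𝕜) z).prodMk ((hasDerivAt_id (0 : 𝕜)).smul_const e)
  have hγ0 : Tendsto (fun s : 𝕜 => (z, s • e)) (𝓝 0) (𝓝 (z, 0)) := by
    simpa using hγ.continuousAt.tendsto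
  have hγ' : HasDerivAt (fun s : 𝕜 => (F z, s • e)) ((0 : E'), e) 0 := by
    simpa using (hasDerivAt_const (0 : 𝕜) (F z)).prodMk ((hasDerivAt_id (0 : 𝕜)).smul_const e)
  have hφ : HasDerivAt (fun s : 𝕜 => (Φ (z, s • e)).1) (fderiv 𝕜 Φ (z, 0) (0, e)).1 0 := by
    have h := HasFDerivAt.comp_hasDerivAt_of_eq (0 : 𝕜) hΦz.hasFDerivAt_fderiv hγ (by simp)
    exact hasFDerivAt_fst.comp_hasDerivAt (0 : 𝕜) h
  have hψ : HasDerivAt (fun s : 𝕜 => (Ψ (F z, s • e)).1) (fderiv 𝕜 Ψ (F z, 0) (0, e)).1 0 := by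
    have h := HasFDerivAt.comp_hasDerivAt_of_eq (0 : 𝕜) hΨz.hasFDerivAt_fderiv hγ' (by simp)
    exact hasFDerivAt_fst.comp_hasDerivAt (0 : 𝕜) h
  have hφ0 : z = (Φ (z, (0 : 𝕜) • e)).1 := by rw [zero_smul, hΦz0]
  have hFφ := HasFDerivAt.comp_hasDerivAt_of_eq (0 : 𝕜) hFz.hasFDerivAt_fderiv hφ hφ0
  have hwφ := HasFDerivAt.comp_hasDerivAt_of_eq (0 : 𝕜) hwz.hasFDerivAt_fderiv hφ hφ0
  have hleft := hFφ.add ((hasDerivAt_id (0 : 𝕜)).smul hwφ)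
  have heq : (fun s : 𝕜 => (Ψ (F z, s • e)).1) =ᶠ[𝓝 0]
      ((F ∘ fun s : 𝕜 => (Φ (z, s • e)).1) +
        (id : 𝕜 → 𝕜) • (w ∘ fun s : 𝕜 => (Φ (z, s • e)).1)) := by
    filter_upwards [hγ0.eventually h1, hγ0.eventually h2] with s hs1 hs2
    have := congrArg Prod.fst hs1
    simp only [hs2] at this
    simpa [he] using this.symm
  have hfin := hψ.unique (hleft.congr_of_eventuallyEq heq)
  simp only [id_eq, zero_smul, one_smul, Function.comp_apply, zero_add, hΦz0] at hfin
  rw [hfin]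
  simp

/-- The bracket of the lifts is a lift: differentiate `dF(ξ) = η ∘ F` and `dF(χ) = ζ ∘ F` along the
other lift and subtract; the second derivatives of `F` cancel by symmetry. -/
theorem IsLiftable.lieBracket {F : E → E'} (hF : IsMapGerm 𝕜 F) {η ζ : E' → E'}
    (hη : IsLiftable 𝕜 F η) (hζ : IsLiftable 𝕜 F ζ) :
    IsLiftable 𝕜 F (VectorField.lieBracket 𝕜 η ζ) := by
  obtain ⟨hηs, ξ, hξs, hξ⟩ := hη
  obtain ⟨hζs, χ, hχs, hχ⟩ := hζ
  refine ⟨(hζs.fderiv_apply hηs).sub (hηs.fderiv_apply hζs), VectorField.lieBracket 𝕜 ξ χ,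
    (hχs.fderiv_apply hξs).sub (hξs.fderiv_apply hχs), ?_⟩
  filter_upwards [hF.smooth, hξs, hχs, hF.tendsto.eventually hηs, hF.tendsto.eventually hζs,
    hξ.eventually_nhds, hχ.eventually_nhds] with x hFx hξx hχx hηx hζx h1 h2
  have key : ∀ {η' : E' → E'} {ξ' : E → E} (v : E), ContDiffAt 𝕜 ∞ η' (F x) →
      (∀ᶠ y in 𝓝 x, fderiv 𝕜 F y (ξ' y) = η' (F y)) →
      fderiv 𝕜 (fun y => fderiv 𝕜 F y (ξ' y)) x v = fderiv 𝕜 η' (F x) (fderiv 𝕜 F x v) := by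
    intro η' ξ' v hη' h
    rw [Filter.EventuallyEq.fderiv_eq h]
    exact congrArg (fun A : E →L[𝕜] E' => A v)
      (hη'.hasFDerivAt_fderiv.comp x hFx.hasFDerivAt_fderiv).fderiv
  rw [VectorField.fderiv_apply_lieBracket (n := ∞) hFx (by simpa using WithTop.coe_le_coe.2 (le_top (a := (2 : ℕ∞))))
    (hχx.differentiableAt (by simp)) (hξx.differentiableAt (by simp)), key _ hζx h2,
    key _ hηx h1, h1.self_of_nhds, h2.self_of_nhds]
  rfl

theorem IsLiftable.add {F : E → E'} {η ζ : E' → E'}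
    (hη : IsLiftable 𝕜 F η) (hζ : IsLiftable 𝕜 F ζ) :
    IsLiftable 𝕜 F fun y => η y + ζ y := by
  obtain ⟨hηs, ξ, hξs, hξ⟩ := hη
  obtain ⟨hζs, χ, hχs, hχ⟩ := hζ
  refine ⟨hηs.add hζs, _, hξs.add hχs, ?_⟩
  filter_upwards [hξ, hχ] with x h1 h2
  rw [map_add, h1, h2]

theorem IsLiftable.smul {F : E → E'} (hF : IsMapGerm 𝕜 F) {a : E' → 𝕜} (ha : SmoothNear 𝕜 a)
    {η : E' → E'} (hη : IsLiftable 𝕜 F η) : IsLiftable 𝕜 F fun y => a y • η y := by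
  obtain ⟨hηs, ξ, hξs, hξ⟩ := hη
  refine ⟨ha.smul hηs, _, (ha.comp hF).smul hξs, ?_⟩
  filter_upwards [hξ] with x h1
  rw [map_smul, h1]

end Calculus

/-! ### The ideal of last components and its derivations -/

section LastComponents

variable {𝕜 : Type*} [RCLike 𝕜]
variable {E : Type*} [NormedAddCommGroup E] [NormedSpace 𝕜 E]
variable {E' : Type*} [NormedAddCommGroup E'] [NormedSpace 𝕜 E']
variable {F : E × 𝕜 → E' × 𝕜}

theorem lastComponents_congr {q q' : E' × 𝕜 → 𝕜} (hq : q ∈ lastComponents 𝕜 F)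
    (h : ∀ᶠ Y in 𝓝 (0 : E' × 𝕜), q' Y = q Y) : q' ∈ lastComponents 𝕜 F := by
  obtain ⟨η, hη, hqη⟩ := hq
  exact ⟨η, hη, by filter_upwards [h, hqη] with Y h1 h2 using h1.trans h2⟩

theorem smoothNear_of_mem_lastComponents {q : E' × 𝕜 → 𝕜} (hq : q ∈ lastComponents 𝕜 F) :
    SmoothNear 𝕜 q := by
  obtain ⟨η, hη, hqη⟩ := hq
  exact hη.1.snd.congr hqη

theorem mul_mem_lastComponents (hF : IsMapGerm 𝕜 F) {a q : E' × 𝕜 → 𝕜} (ha : SmoothNear 𝕜 a)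
    (hq : q ∈ lastComponents 𝕜 F) : (fun Y => a Y * q Y) ∈ lastComponents 𝕜 F := by
  obtain ⟨η, hη, hqη⟩ := hq
  refine ⟨_, hη.smul hF ha, ?_⟩
  filter_upwards [hqη] with Y h
  simp [h]

theorem mem_lastComponents_of_mul_mem (hF : IsMapGerm 𝕜 F) {a q : E' × 𝕜 → 𝕜}
    (ha : SmoothNear 𝕜 a) (ha0 : a 0 ≠ 0) (h : (fun Y => a Y * q Y) ∈ lastComponents 𝕜 F) :
    q ∈ lastComponents 𝕜 F := by
  refine lastComponents_congr (mul_mem_lastComponents hF (ha.inv ha0) h) ?_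
  filter_upwards [ha.eventually_ne ha0] with Y hY
  rw [inv_mul_cancel_left₀ hY]

/-- The ideal generated by `dπ(Lift F)` and `Λ` is invariant under every liftable field whose last
component is a multiple of `Λ`. -/
theorem exists_fderiv_add_mem_lastComponents (hF : IsMapGerm 𝕜 F) {η : E' × 𝕜 → E' × 𝕜}
    (hη : IsLiftable 𝕜 F η) {c : E' × 𝕜 → 𝕜} (hc : SmoothNear 𝕜 c)
    (hηc : ∀ᶠ Y in 𝓝 (0 : E' × 𝕜), (η Y).2 = Y.2 * c Y) {q β : E' × 𝕜 → 𝕜}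
    (hqs : SmoothNear 𝕜 q) (hβ : SmoothNear 𝕜 β)
    (hq : (fun Y => q Y + Y.2 * β Y) ∈ lastComponents 𝕜 F) :
    ∃ γ : E' × 𝕜 → 𝕜, SmoothNear 𝕜 γ ∧
      (fun Y => fderiv 𝕜 q Y (η Y) + Y.2 * γ Y) ∈ lastComponents 𝕜 F := by
  obtain ⟨ζ, hζ, hqζ⟩ := hq
  have hcζ := hc.fderiv_apply hζ.1
  have hβη := hβ.fderiv_apply hη.1
  -- Read off from the last component of `[η, ζ] + c ζ`; adding `c ζ` cancels the term `-c ζ₂` that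
  -- comes from differentiating `η₂ = Λ c` along `ζ`.
  refine ⟨fun Y => c Y * β Y + fderiv 𝕜 β Y (η Y) - fderiv 𝕜 c Y (ζ Y),
    ((hc.mul hβ).add hβη).sub hcζ, _, (hη.lieBracket hF hζ).add (hζ.smul hF hc), ?_⟩
  filter_upwards [hqζ.eventually_nhds, hηc.eventually_nhds, hqs, hβ, hc, hη.1, hζ.1]
    with Y hqY hηY hqs hβs hcs hηs hζs
  have h2 : HasFDerivAt (fun Y : E' × 𝕜 => Y.2) (ContinuousLinearMap.snd 𝕜 E' 𝕜) Y :=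
    hasFDerivAt_snd
  have e1 := (hηs.hasFDerivAt_fderiv.snd.congr_of_eventuallyEq
    (hηY.mono fun _ h => h.symm)).unique (h2.mul hcs.hasFDerivAt_fderiv)
  have e2 := (hζs.hasFDerivAt_fderiv.snd.congr_of_eventuallyEq hqY).unique
    (hqs.hasFDerivAt_fderiv.add (h2.mul hβs.hasFDerivAt_fderiv))
  have e1' := congrArg (fun A : E' × 𝕜 →L[𝕜] 𝕜 => A (ζ Y)) e1
  have e2' := congrArg (fun A : E' × 𝕜 →L[𝕜] 𝕜 => A (η Y)) e2
  have e3 := hqY.self_of_nhds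
  have e4 := hηY.self_of_nhds
  simp at e1' e2'
  simp [VectorField.lieBracket, e1', e2', e4, ← e3]
  ring

/-- Differentiating `L ^ (k + 1)` along `η` gives `(k + 1) L(η) L ^ k`, whose coefficient `(k + 1)
L(η)` is a unit at `0`. After lowering the exponent to `0`, what remains is the unit `1 + Λ β`. -/
theorem one_mem_lastComponents_of_pow (hF : IsMapGerm 𝕜 F) {η : E' × 𝕜 → E' × 𝕜}
    (hη : IsLiftable 𝕜 F η) {c : E' × 𝕜 → 𝕜} (hc : SmoothNear 𝕜 c)
    (hηc : ∀ᶠ Y in 𝓝 (0 : E' × 𝕜), (η Y).2 = Y.2 * c Y) (L : E' × 𝕜 →L[𝕜] 𝕜)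
    (hL : L (η 0) ≠ 0) (k : ℕ) :
    ∀ β : E' × 𝕜 → 𝕜, SmoothNear 𝕜 β → (fun Y => L Y ^ k + Y.2 * β Y) ∈ lastComponents 𝕜 F →
      (fun _ => (1 : 𝕜)) ∈ lastComponents 𝕜 F := by
  have hLη : SmoothNear 𝕜 fun Y => L (η Y) := hη.1.mono fun _ h => L.contDiff.contDiffAt.comp _ h
  induction k with
  | zero =>
    intro β hβ h
    refine mem_lastComponents_of_mul_mem hF (smoothNear_of_mem_lastComponents h) (by simp) ?_
    simpa using h
  | succ k ih =>
    intro β hβ h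
    obtain ⟨γ, hγ, hmem⟩ := exists_fderiv_add_mem_lastComponents hF hη hc hηc
      (L.contDiff.pow (k + 1)).smoothNear hβ h
    have ha : SmoothNear 𝕜 fun Y => ((k + 1 : ℕ) : 𝕜) * L (η Y) :=
      (contDiff_const (c := ((k + 1 : ℕ) : 𝕜))).smoothNear.mul hLη
    have ha0 : ((k + 1 : ℕ) : 𝕜) * L (η 0) ≠ 0 :=
      mul_ne_zero (Nat.cast_ne_zero.2 k.succ_ne_zero) hL
    refine ih (fun Y => (((k + 1 : ℕ) : 𝕜) * L (η Y))⁻¹ * γ Y) ((ha.inv ha0).mul hγ)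
      (mem_lastComponents_of_mul_mem hF ha ha0 (lastComponents_congr hmem ?_))
    filter_upwards [ha.eventually_ne ha0] with Y hY
    have hd : fderiv 𝕜 (fun Y => L Y ^ (k + 1)) Y (η Y) =
        ((k + 1 : ℕ) : 𝕜) * L (η Y) * L Y ^ k := by
      rw [(L.hasFDerivAt.pow (k + 1)).fderiv]
      simp
      ring
    rw [hd, mul_add, mul_left_comm _ Y.2, mul_inv_cancel_left₀ hY]

end LastComponents

/-! ### Consequences of `𝒜`-finiteness for the OPSU -/

section Unfolding

universe u

variable {𝕜 : Type u} [RCLike 𝕜]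
variable {E : Type u} [NormedAddCommGroup E] [NormedSpace 𝕜 E]
variable {E' : Type u} [NormedAddCommGroup E'] [NormedSpace 𝕜 E']

theorem IsUnfolding.eventually_fderiv_apply {P : Type*} [NormedAddCommGroup P] [NormedSpace 𝕜 P]
    {f : E → E'} {F : E × P → E' × P} (hF : IsUnfolding 𝕜 f F) :
    ∀ᶠ x in 𝓝 (0 : E), ∀ (v : E) (b : P), fderiv 𝕜 F (x, 0) (v, b) =
      (fderiv 𝕜 f x v + (fderiv 𝕜 F (x, 0) (0, b)).1, b) := by
  have hi : Tendsto (fun x : E => (x, (0 : P))) (𝓝 0) (𝓝 0) :=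
    (isMapGerm_prodMk_zero (𝕜 := 𝕜)).tendsto
  filter_upwards [hi.eventually hF.isMapGerm.smooth, hi.eventually hF.snd_eq.eventually_nhds,
    hF.fst_eq.eventually_nhds] with x hs h2 h1 v b
  have hd := hs.hasFDerivAt_fderiv
  have e2 := (hd.snd.congr_of_eventuallyEq (h2.mono fun _ h => h.symm)).unique hasFDerivAt_snd
  have e1 := ((HasFDerivAt.comp (f := fun e : E => (e, (0 : P))) x hd.fst
    (hasFDerivAt_prodMk_left x 0)).congr_of_eventuallyEq
    (h1.mono fun _ h => h.symm)).fderiv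
  refine Prod.ext ?_ ?_
  · have : ((v, b) : E × P) = (v, 0) + (0, b) := by simp
    rw [this, map_add, e1]
    simp
  · exact congrArg (fun A : E × P →L[𝕜] P => A (v, b)) e2

/-- Let `f'` be the `λ`-derivative of `f_λ` at `λ = 0`. The fields `P(ℓ ∘ f) f'`, with `P` a
polynomial, cannot inject into the finite-dimensional normal space, so some `P ≠ 0` gives a tangent
field. This yields a liftable field with last component `P(ℓ)` modulo `Λ`. Writing `P = t ^ k Q`
with `Q(0) ≠ 0`, the unit `Q(ℓ)` can be divided out. -/
theorem exists_pow_add_mem_lastComponents [CompleteSpace E'] {f : E → E'} {F : E × 𝕜 → E' × 𝕜}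
    (hf : IsMapGerm 𝕜 f) (hfin : IsAFinite 𝕜 f) (hF : IsOPSU 𝕜 f F) (ℓ : E' →L[𝕜] 𝕜) :
    ∃ (k : ℕ) (β : E' × 𝕜 → 𝕜), SmoothNear 𝕜 β ∧
      (fun Y => ℓ Y.1 ^ k + Y.2 * β Y) ∈ lastComponents 𝕜 F := by
  obtain ⟨hFu, hst⟩ := hF
  have hFg := hFu.isMapGerm
  have hpoly : ∀ P : Polynomial 𝕜, ContDiff 𝕜 ∞ fun Y : E' => P.eval (ℓ Y) := fun P => by
    simpa [Function.comp_def] using (P.contDiff_aeval (𝕜 := 𝕜) ∞).comp ℓ.contDiff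
  have hdot : SmoothNear 𝕜 fun x => (fderiv 𝕜 F (x, 0) (0, 1)).1 :=
    ((hFg.smooth.fderiv_apply contDiff_const.smoothNear).comp isMapGerm_prodMk_zero).fst
  let T : Polynomial 𝕜 →ₗ[𝕜] fieldsAlong 𝕜 E E' :=
    { toFun := fun P => ⟨fun x => P.eval (ℓ (f x)) • (fderiv 𝕜 F (x, 0) (0, 1)).1,
        ((hpoly P).smoothNear.comp hf).smul hdot⟩
      map_add' := fun P Q => by ext1; funext x; simp [add_smul]
      map_smul' := fun a P => by ext1; funext x; simp [mul_smul] }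
  have hker : ∃ P ≠ 0, T P ∈ extTangentA 𝕜 f := by
    by_contra! hcon
    have hinj : Function.Injective ((extTangentA 𝕜 f).mkQ ∘ₗ T) := by
      rw [injective_iff_map_eq_zero]
      intro P hP
      by_contra hP0
      exact hcon P hP0 (by simpa using hP)
    have : FiniteDimensional 𝕜 (fieldsAlong 𝕜 E E' ⧸ extTangentA 𝕜 f) := hfin
    exact Polynomial.not_finite (R := 𝕜) (Module.Finite.of_injective _ hinj)
  obtain ⟨P, hP0, ξ, hξ, η, hη, hPξη⟩ := hker
  obtain ⟨Q, hPQ, hQ⟩ := Polynomial.exists_eq_pow_rootMultiplicity_mul_and_not_dvd P hP0 0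
  set k := P.rootMultiplicity 0
  have hQ0 : Q.eval 0 ≠ 0 := by
    intro h
    exact hQ (Polynomial.dvd_iff_isRoot.2 h)
  -- From `P(ℓ ∘ f) f' = df(ξ) + η ∘ f`, the equation `dF(ξ') = η' ∘ F` holds along `λ = 0`.
  set ξ' : E × 𝕜 → E × 𝕜 := fun z => (-ξ z.1, P.eval (ℓ (F z).1)) with hξ'
  set η' : E' × 𝕜 → E' × 𝕜 := fun Y => (η Y.1, P.eval (ℓ Y.1)) with hη'
  have hη's : SmoothNear 𝕜 η' :=
    (SmoothNear.comp hη isMapGerm_fst).prodMk ((hpoly P).smoothNear.comp isMapGerm_fst)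
  have hξ's : SmoothNear 𝕜 ξ' :=
    (SmoothNear.comp hξ isMapGerm_fst).neg.prodMk
      (((hpoly P).smoothNear.comp isMapGerm_fst).comp hFg)
  have hv0 : ∀ᶠ x in 𝓝 (0 : E), fderiv 𝕜 F (x, 0) (ξ' (x, 0)) - η' (F (x, 0)) = 0 := by
    filter_upwards [hFu.eventually_fderiv_apply, hFu.fst_eq, hPξη] with x h1 h2 h3
    have h4 : ((0 : E), P.eval (ℓ (f x))) = P.eval (ℓ (f x)) • ((0 : E), (1 : 𝕜)) := by simp
    have h3' : P.eval (ℓ (f x)) • (fderiv 𝕜 F (x, 0) (0, 1)).1 =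
      fderiv 𝕜 f x (ξ x) + η (f x) := h3
    simp only [hξ', hη', h2]
    rw [h1, h4, map_smul, Prod.smul_fst, h3']
    simp
  -- The error off `λ = 0` is `λ w`, and infinitesimal stability writes `w = dF(α) + β ∘ F`.
  -- Replacing `ξ'` by `ξ' - λ α` and `η'` by `η' + Λ β` makes the lift exact without changing last
  -- components modulo `Λ`.
  obtain ⟨w, hw, hvw⟩ :=
    ((hFg.smooth.fderiv_apply hξ's).sub (hη's.comp hFg)).exists_eq_snd_smul hv0
  obtain ⟨α, hα, β, hβ, hwαβ⟩ := hst.exists_eq_fderiv_add hw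
  have hlift : IsLiftable 𝕜 F fun Y => η' Y + Y.2 • β Y := by
    refine ⟨hη's.add (smoothNear_snd.smul hβ), fun z => ξ' z - z.2 • α z,
      hξ's.sub (smoothNear_snd.smul hα), ?_⟩
    filter_upwards [hvw, hwαβ, hFu.snd_eq] with z h1 h2 h3
    rw [map_sub, map_smul, h3, sub_eq_iff_eq_add.1 h1, h2]
    module
  have hmem : (fun Y : E' × 𝕜 => P.eval (ℓ Y.1) + Y.2 * (β Y).2) ∈ lastComponents 𝕜 F :=
    ⟨_, hlift, Eventually.of_forall fun Y => by simp [hη']⟩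
  have hQs : SmoothNear 𝕜 fun Y : E' × 𝕜 => Q.eval (ℓ Y.1) :=
    (hpoly Q).smoothNear.comp isMapGerm_fst
  have hQs0 : Q.eval (ℓ (0 : E' × 𝕜).1) ≠ 0 := by simpa using hQ0
  refine ⟨k, fun Y => (Q.eval (ℓ Y.1))⁻¹ * (β Y).2, (hQs.inv hQs0).mul hβ.snd,
    mem_lastComponents_of_mul_mem hFg hQs hQs0 (lastComponents_congr hmem ?_)⟩
  filter_upwards [hQs.eventually_ne hQs0] with Y hY
  have : P.eval (ℓ Y.1) = ℓ Y.1 ^ k * Q.eval (ℓ Y.1) := by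
    conv_lhs => rw [hPQ]
    simp
  rw [this]
  field_simp

/-- If `f` is `𝒜`-finite, a liftable field of the OPSU `F` that is tangent to `Λ = 0` and does not
vanish at `0` forces `dπ(Lift F)` to be the unit ideal. -/
theorem one_mem_lastComponents_of_ne_zero [FiniteDimensional 𝕜 E'] {f : E → E'}
    {F : E × 𝕜 → E' × 𝕜} (hf : IsMapGerm 𝕜 f) (hfin : IsAFinite 𝕜 f) (hF : IsOPSU 𝕜 f F)
    {η : E' × 𝕜 → E' × 𝕜} (hη : IsLiftable 𝕜 F η) {c : E' × 𝕜 → 𝕜} (hc : SmoothNear 𝕜 c)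
    (hηc : ∀ᶠ Y in 𝓝 (0 : E' × 𝕜), (η Y).2 = Y.2 * c Y) (hη0 : η 0 ≠ 0) :
    (fun _ => (1 : 𝕜)) ∈ lastComponents 𝕜 F := by
  have _ : CompleteSpace E' := FiniteDimensional.complete 𝕜 E'
  have h2 : (η 0).2 = 0 := by simpa using hηc.self_of_nhds
  have h1 : (η 0).1 ≠ 0 := fun h => hη0 (Prod.ext h h2)
  obtain ⟨ℓ, hℓ⟩ := SeparatingDual.exists_ne_zero (R := 𝕜) h1
  obtain ⟨k, β, hβ, h⟩ := exists_pow_add_mem_lastComponents hf hfin hF ℓ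
  exact one_mem_lastComponents_of_pow hF.1.isMapGerm hη hc hηc
    (ℓ.comp (ContinuousLinearMap.fst 𝕜 E' 𝕜)) hℓ k β hβ h

end Unfolding

/-! ### Transport along weak equivalences -/

section WeakEquivalence

variable {𝕜 : Type*} [RCLike 𝕜]
variable {E : Type*} [NormedAddCommGroup E] [NormedSpace 𝕜 E]
variable {E' : Type*} [NormedAddCommGroup E'] [NormedSpace 𝕜 E']

theorem IsLiftable.pushforward {F G : E → E'} {Φ Θ : E → E} {Ψ Ξ : E' → E'}
    (hF : IsMapGerm 𝕜 F) (hG : IsMapGerm 𝕜 G) (hΦ : IsMapGerm 𝕜 Φ) (hΘ : IsMapGerm 𝕜 Θ)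
    (hΨ : IsMapGerm 𝕜 Ψ) (hΞ : IsMapGerm 𝕜 Ξ) (hΦΘ : ∀ᶠ x in 𝓝 (0 : E), Φ (Θ x) = x)
    (hΞΨ : ∀ᶠ y in 𝓝 (0 : E'), Ξ (Ψ y) = y) (h : ∀ᶠ z in 𝓝 (0 : E), G (Φ z) = Ψ (F z))
    {η : E' → E'} (hη : IsLiftable 𝕜 F η) :
    IsLiftable 𝕜 G fun y => fderiv 𝕜 Ψ (Ξ y) (η (Ξ y)) := by
  obtain ⟨hηs, ξ, hξs, hξ⟩ := hη
  refine ⟨(hΨ.smooth.fderiv_apply hηs).comp hΞ, fun x => fderiv 𝕜 Φ (Θ x) (ξ (Θ x)),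
    (hΦ.smooth.fderiv_apply hξs).comp hΘ, ?_⟩
  filter_upwards [hΦΘ, hG.smooth, hΘ.tendsto.eventually hΦ.smooth,
    hΘ.tendsto.eventually hF.smooth, hΘ.tendsto.eventually (hF.tendsto.eventually hΨ.smooth),
    hΘ.tendsto.eventually (hF.tendsto.eventually hΞΨ), hΘ.tendsto.eventually h.eventually_nhds,
    hΘ.tendsto.eventually hξ] with x hx hGx hΦx hFx hΨx hΞx hzx hξx
  have h1 : HasFDerivAt G (fderiv 𝕜 G x) (Φ (Θ x)) := by rw [hx]; exact hGx.hasFDerivAt_fderiv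
  have h2 := ((h1.comp (Θ x) hΦx.hasFDerivAt_fderiv).congr_of_eventuallyEq
    (hzx.mono fun _ h => h.symm)).unique
    (hΨx.hasFDerivAt_fderiv.comp (Θ x) hFx.hasFDerivAt_fderiv)
  have h3 := congrArg (fun A : E →L[𝕜] E' => A (ξ (Θ x))) h2
  have h4 : Ξ (G x) = F (Θ x) := by
    have := hzx.self_of_nhds
    rw [hx] at this
    rw [this, hΞx]
  simp only [ContinuousLinearMap.comp_apply, hξx] at h3
  rw [h4]
  exact h3

theorem fderiv_ne_zero_of_leftInverse {Ψ Ξ : E → E} (hΨ : IsMapGerm 𝕜 Ψ) (hΞ : IsMapGerm 𝕜 Ξ)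
    (h : ∀ᶠ y in 𝓝 (0 : E), Ξ (Ψ y) = y) {v : E} (hv : v ≠ 0) : fderiv 𝕜 Ψ 0 v ≠ 0 := by
  intro h0
  have hΞ0 : HasFDerivAt Ξ (fderiv 𝕜 Ξ 0) (Ψ 0) := by
    rw [hΨ.map_zero]
    exact hΞ.smooth.self_of_nhds.hasFDerivAt_fderiv
  have h1 := hΞ0.comp 0 hΨ.smooth.self_of_nhds.hasFDerivAt_fderiv
  have h2 := (h1.congr_of_eventuallyEq (h.mono fun _ h => h.symm)).unique (hasFDerivAt_id 0)
  have h3 := congrArg (fun A : E →L[𝕜] E => A v) h2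
  simp [h0] at h3
  exact hv h3.symm

/-- For an inverse `Θ`, `λ = Θ₂ · (a ∘ Θ)`. If `a 0 = 0`, both factors vanish at `0`, hence so does
the derivative of the product, whereas that of `λ` is nonzero. -/
theorem IsWeakDiffeo.exists_cofactor {Φ : E × 𝕜 → E × 𝕜} (hΦ : IsWeakDiffeo 𝕜 Φ) :
    ∃ a : E × 𝕜 → 𝕜, SmoothNear 𝕜 a ∧ a 0 ≠ 0 ∧ ∀ᶠ z in 𝓝 (0 : E × 𝕜), (Φ z).2 = z.2 * a z := by
  obtain ⟨⟨hΦg, Θ, hΘ, hΘΦ, hΦΘ⟩, a, ha, hΦa⟩ := hΦ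
  refine ⟨a, ha, fun h0 => ?_, hΦa⟩
  have h1 : ∀ᶠ z in 𝓝 (0 : E × 𝕜), z.2 = (Θ z).2 * a (Θ z) := by
    filter_upwards [hΦΘ, hΘ.tendsto.eventually hΦa] with z h1 h2
    rw [← h2, h1]
  have h2 := (hΘ.smooth.snd.self_of_nhds.hasFDerivAt_fderiv.mul
    (ha.comp hΘ).self_of_nhds.hasFDerivAt_fderiv).congr_of_eventuallyEq h1
  have h3 := h2.unique hasFDerivAt_snd
  have h4 := congrArg (fun A : E × 𝕜 →L[𝕜] 𝕜 => A (0, 1)) h3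
  simp [hΘ.map_zero, h0] at h4

theorem IsWeakDiffeo.exists_inverse {Φ : E × 𝕜 → E × 𝕜} (hΦ : IsWeakDiffeo 𝕜 Φ) :
    ∃ Θ : E × 𝕜 → E × 𝕜, IsWeakDiffeo 𝕜 Θ ∧ (∀ᶠ z in 𝓝 (0 : E × 𝕜), Θ (Φ z) = z) ∧
      ∀ᶠ z in 𝓝 (0 : E × 𝕜), Φ (Θ z) = z := by
  obtain ⟨a, ha, ha0, hΦa⟩ := hΦ.exists_cofactor
  obtain ⟨⟨hΦg, Θ, hΘ, hΘΦ, hΦΘ⟩, -⟩ := hΦ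
  have haΘ0 : a (Θ 0) ≠ 0 := by rwa [hΘ.map_zero]
  refine ⟨Θ, ⟨⟨hΘ, Φ, hΦg, hΦΘ, hΘΦ⟩, fun z => (a (Θ z))⁻¹, (ha.comp hΘ).inv haΘ0, ?_⟩,
    hΘΦ, hΦΘ⟩
  filter_upwards [hΦΘ, hΘ.tendsto.eventually hΦa, (ha.comp hΘ).eventually_ne haΘ0] with z h1 h2 h3
  rw [eq_mul_inv_iff_mul_eq₀ h3, ← h2, h1]

theorem WeakEquivalent.symm {F G : E × 𝕜 → E' × 𝕜} (hF : IsMapGerm 𝕜 F)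
    (h : WeakEquivalent 𝕜 F G) : WeakEquivalent 𝕜 G F := by
  obtain ⟨Φ, Ψ, hΦ, hΨ, h⟩ := h
  obtain ⟨Θ, hΘ, -, hΦΘ⟩ := hΦ.exists_inverse
  obtain ⟨Ξ, hΞ, hΞΨ, -⟩ := hΨ.exists_inverse
  refine ⟨Θ, Ξ, hΘ, hΞ, ?_⟩
  have hΘt := hΘ.1.1.tendsto
  filter_upwards [hΦΘ, hΘt.eventually h, hΘt.eventually (hF.tendsto.eventually hΞΨ)] with z h1 h2 h3
  rw [← h3, ← h2, h1]

/-- Liftable fields are carried along a weak equivalence. The fields with last component `1` go to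
fields whose last component is a unit; those with last component `Λ` go to fields whose last
component is `Λ c`, where `c` is a unit if the field vanishes at `0`. -/
theorem WeakEquivalent.exists_isLiftable {F G : E × 𝕜 → E' × 𝕜} (hF : IsMapGerm 𝕜 F)
    (hG : IsMapGerm 𝕜 G) (h : WeakEquivalent 𝕜 F G) {η : E' × 𝕜 → E' × 𝕜}
    (hη : IsLiftable 𝕜 F η) :
    ∃ η' : E' × 𝕜 → E' × 𝕜, IsLiftable 𝕜 G η' ∧ (η 0 ≠ 0 → η' 0 ≠ 0) ∧
      ((∀ᶠ Y in 𝓝 (0 : E' × 𝕜), (η Y).2 = 1) → (η' 0).2 ≠ 0) ∧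
      ((∀ᶠ Y in 𝓝 (0 : E' × 𝕜), (η Y).2 = Y.2) → ∃ c : E' × 𝕜 → 𝕜, SmoothNear 𝕜 c ∧
        (∀ᶠ Y in 𝓝 (0 : E' × 𝕜), (η' Y).2 = Y.2 * c Y) ∧ (η 0 = 0 → c 0 ≠ 0)) := by
  obtain ⟨Φ, Ψ, hΦ, hΨ, h⟩ := h
  obtain ⟨Θ, hΘ, -, hΦΘ⟩ := hΦ.exists_inverse
  obtain ⟨Ξ, hΞ, hΞΨ, -⟩ := hΨ.exists_inverse
  obtain ⟨a, ha, ha0, hΨa⟩ := hΨ.exists_cofactor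
  obtain ⟨b, hb, hb0, hΞb⟩ := hΞ.exists_cofactor
  have hΨg := hΨ.1.1
  have hΞg := hΞ.1.1
  have hsnd : ∀ᶠ Z in 𝓝 (0 : E' × 𝕜),
      (fderiv 𝕜 Ψ Z (η Z)).2 = a Z * (η Z).2 + Z.2 * fderiv 𝕜 a Z (η Z) := by
    filter_upwards [hΨa.eventually_nhds, hΨg.smooth, ha] with Z h1 h2 h3
    have e := (h2.hasFDerivAt_fderiv.snd.congr_of_eventuallyEq (h1.mono fun _ h => h.symm)).unique
      ((hasFDerivAt_snd (𝕜 := 𝕜) (p := Z)).mul h3.hasFDerivAt_fderiv)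
    have e' := congrArg (fun A : E' × 𝕜 →L[𝕜] 𝕜 => A (η Z)) e
    simp at e'
    rw [e']
    ring
  refine ⟨_, hη.pushforward hF hG hΦ.1.1 hΘ.1.1 hΨg hΞg hΦΘ hΞΨ h, ?_, ?_, ?_⟩
  · intro h0
    simpa [hΞg.map_zero] using fderiv_ne_zero_of_leftInverse hΨg hΞg hΞΨ h0
  · intro h1
    have e := hsnd.self_of_nhds
    simpa [hΞg.map_zero, e, h1.self_of_nhds] using ha0
  · intro h1
    -- At `0` this is `b(0) (a(0) + da(η(0)))`; the second summand could destroy the unit unless `η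
    -- 0 = 0`.
    refine ⟨fun Y => b Y * (a (Ξ Y) + fderiv 𝕜 a (Ξ Y) (η (Ξ Y))),
      hb.mul ((ha.add (ha.fderiv_apply hη.1)).comp hΞg), ?_, ?_⟩
    · filter_upwards [hΞg.tendsto.eventually hsnd, hΞg.tendsto.eventually h1, hΞb] with Y e1 e2 e3
      rw [e1, e2, e3]
      ring
    · intro h0
      simpa [hΞg.map_zero, h0] using ⟨hb0, ha0⟩

theorem one_mem_lastComponents_of_snd_ne_zero {F : E × 𝕜 → E' × 𝕜} (hF : IsMapGerm 𝕜 F)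
    {η : E' × 𝕜 → E' × 𝕜} (hη : IsLiftable 𝕜 F η) (h : (η 0).2 ≠ 0) :
    (fun _ => (1 : 𝕜)) ∈ lastComponents 𝕜 F :=
  mem_lastComponents_of_mul_mem hF hη.1.snd h ⟨η, hη, Eventually.of_forall fun _ => by simp⟩

theorem snd_mem_lastComponents_of_one_mem {F : E × 𝕜 → E' × 𝕜} (hF : IsMapGerm 𝕜 F)
    (h : (fun _ => (1 : 𝕜)) ∈ lastComponents 𝕜 F) :
    (fun Y : E' × 𝕜 => Y.2) ∈ lastComponents 𝕜 F := by
  simpa using mul_mem_lastComponents hF smoothNear_snd h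

theorem WeakEquivalent.one_mem_lastComponents {F G : E × 𝕜 → E' × 𝕜} (hF : IsMapGerm 𝕜 F)
    (hG : IsMapGerm 𝕜 G) (h : WeakEquivalent 𝕜 F G)
    (h1 : (fun _ => (1 : 𝕜)) ∈ lastComponents 𝕜 F) :
    (fun _ => (1 : 𝕜)) ∈ lastComponents 𝕜 G := by
  obtain ⟨η, hη, hη1⟩ := h1
  obtain ⟨η', hη', -, h', -⟩ := h.exists_isLiftable hF hG hη
  exact one_mem_lastComponents_of_snd_ne_zero hG hη' (h' (hη1.mono fun _ h => h.symm))

theorem mem_lastComponents_snd_of_eq_mul {F : E × 𝕜 → E' × 𝕜} (hF : IsMapGerm 𝕜 F)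
    {η : E' × 𝕜 → E' × 𝕜} (hη : IsLiftable 𝕜 F η) {c : E' × 𝕜 → 𝕜} (hc : SmoothNear 𝕜 c)
    (hc0 : c 0 ≠ 0) (h : ∀ᶠ Y in 𝓝 (0 : E' × 𝕜), (η Y).2 = Y.2 * c Y) :
    (fun Y : E' × 𝕜 => Y.2) ∈ lastComponents 𝕜 F :=
  mem_lastComponents_of_mul_mem hF hc hc0
    ⟨η, hη, h.mono fun Y hY => by rw [hY, mul_comm]⟩

/-- If exponent `0` is allowed, `1` in the ideal makes the degree `0`; if exponents start at `1`,
the second condition is void. -/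
theorem isSubstantial_iff {m₀ : ℕ} (hm₀ : m₀ = 0 ∨ m₀ = 1) {F : E × 𝕜 → E' × 𝕜} :
    IsSubstantial 𝕜 m₀ F ↔ (fun Y : E' × 𝕜 => Y.2) ∈ lastComponents 𝕜 F ∧
      (m₀ = 0 → (fun _ => (1 : 𝕜)) ∉ lastComponents 𝕜 F) := by
  unfold IsSubstantial degreeOfSubstantiality
  set S : Set ℕ := {m | m₀ ≤ m ∧ (fun Y : E' × 𝕜 => Y.2 ^ m) ∈ lastComponents 𝕜 F} with hS
  have h1 : 1 ∈ S ↔ (fun Y : E' × 𝕜 => Y.2) ∈ lastComponents 𝕜 F := by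
    have : m₀ ≤ 1 := by omega
    simp [hS, this]
  have h0 : 0 ∈ S ↔ m₀ = 0 ∧ (fun _ => (1 : 𝕜)) ∈ lastComponents 𝕜 F := by simp [hS]
  have hinf : (⨅ (m : ℕ) (_ : m ∈ S), (m : ℕ∞)) = 1 ↔ 1 ∈ S ∧ 0 ∉ S := by
    constructor
    · intro h
      have h0' : 0 ∉ S := fun h0 => by
        have : (⨅ (m : ℕ) (_ : m ∈ S), (m : ℕ∞)) ≤ (0 : ℕ) := iInf₂_le 0 h0
        rw [h] at this
        simp at this
      refine ⟨?_, h0'⟩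
      by_contra h1'
      have : (2 : ℕ∞) ≤ ⨅ (m : ℕ) (_ : m ∈ S), (m : ℕ∞) := by
        refine le_iInf₂ fun m hm => ?_
        have h2 : 2 ≤ m := by
          rcases m with _ | _ | m
          · exact absurd hm h0'
          · exact absurd hm h1'
          · omega
        exact_mod_cast h2
      rw [h] at this
      exact absurd this (by decide)
    · rintro ⟨h1', h0'⟩
      refine le_antisymm (by simpa using iInf₂_le (f := fun m (_ : m ∈ S) => (m : ℕ∞)) 1 h1') ?_
      refine le_iInf₂ fun m hm => ?_
      have : 1 ≤ m := Nat.one_le_iff_ne_zero.2 fun h => h0' (h ▸ hm)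
      exact_mod_cast this
  have := hinf
  rw [h1, h0] at this
  simpa [hS] using this

end WeakEquivalence

end Unfoldings

theorem mainTheorem11 {𝕜 : Type*} [RCLike 𝕜] (n p : ℕ)
    (f g : (Fin n → 𝕜) → (Fin p → 𝕜))
    (F G : (Fin n → 𝕜) × 𝕜 → (Fin p → 𝕜) × 𝕜)
    (hf : Unfoldings.IsMapGerm 𝕜 f) (hg : Unfoldings.IsMapGerm 𝕜 g)
    (hfin : Unfoldings.IsAFinite 𝕜 f)
    (hF : Unfoldings.IsOPSU 𝕜 f F) (hG : Unfoldings.IsOPSU 𝕜 g G)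
    (hFG : Unfoldings.WeakEquivalent 𝕜 F G)
    (m₀ : ℕ) (hm₀ : m₀ = 0 ∨ m₀ = 1) :
    Unfoldings.IsSubstantial 𝕜 m₀ F ↔ Unfoldings.IsSubstantial 𝕜 m₀ G := by
  open Unfoldings in
  have hFg := hF.1.isMapGerm
  have hGg := hG.1.isMapGerm
  have hGF := hFG.symm hFg
  have hone : (fun _ => (1 : 𝕜)) ∈ lastComponents 𝕜 F ↔ (fun _ => (1 : 𝕜)) ∈ lastComponents 𝕜 G :=
    ⟨hFG.one_mem_lastComponents hFg hGg, hGF.one_mem_lastComponents hGg hFg⟩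
  rw [isSubstantial_iff hm₀, isSubstantial_iff hm₀, hone]
  refine and_congr_left fun _ => ?_
  by_cases h1 : (fun _ => (1 : 𝕜)) ∈ lastComponents 𝕜 F
  · exact iff_of_true (snd_mem_lastComponents_of_one_mem hFg h1)
      (snd_mem_lastComponents_of_one_mem hGg (hone.1 h1))
  constructor
  · rintro ⟨η, hη, hη2⟩
    have hη0 : η 0 = 0 := by
      by_contra h0
      exact h1 (one_mem_lastComponents_of_ne_zero hf hfin hF hη
        (c := fun _ => 1) contDiff_const.smoothNear (hη2.mono fun Y h => by simp [h]) h0)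
    obtain ⟨η', hη', -, -, hc⟩ := hFG.exists_isLiftable hFg hGg hη
    obtain ⟨c, hc, hηc, hc0⟩ := hc (hη2.mono fun _ h => h.symm)
    exact mem_lastComponents_snd_of_eq_mul hGg hη' hc (hc0 hη0) hηc
  · rintro ⟨η, hη, hη2⟩
    -- Only `f` is assumed `𝒜`-finite, so nonvanishing of `η 0` is moved to the `F` side before
    -- deriving the contradiction. There the last component is only `Λ c`, which is why the
    -- criterion allows a cofactor.
    obtain ⟨η', hη', hne, -, hc⟩ := hGF.exists_isLiftable hGg hFg hη
    obtain ⟨c, hc, hηc, hc0⟩ := hc (hη2.mono fun _ h => h.symm)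
    have hη0 : η 0 = 0 := by
      by_contra h0
      exact h1 (one_mem_lastComponents_of_ne_zero hf hfin hF hη' hc hηc (hne h0))
    exact mem_lastComponents_snd_of_eq_mul hFg hη' hc (hc0 hη0) hηc
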